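/- A graph has a finite set of vertices and a finite set of edges; each edge is a normal edge (incident with two distinct vertices, adding $1$ to the degree of each), a loop (incident with one vertex, adding $2$ to its degree) or a semi-edge (incident with one vertex, adding $1$ to its degree). Multiple edges of each kind are allowed, and graphs need not be connected. A graph is simple if it has no loops, no semi-edges and no two normal edges with the same end-vertices. A graph $G$ covers a graph $H$ if there are surjective maps $f_V:V(G)\to V(H)$ and $f_E:E(G)\to E(H)$ such that $f_V$ preserves degrees; $f_E$ maps semi-edges to semi-edges and loops to loops; the end-vertices of $f_E(e)$ are the images under $f_V$ of the end-vertices of $e$, for every $e\in E(G)$; and for every $u\in V(G)$ the map $f_E$ is bijective from the edge-neighbourhood of $u$ to that of $f_V(u)$, loops being counted twice, that is, for every $e'\in E(H)$ the edges in $f_E^{-1}(e')$ contribute together to the degree of $u$ exactly what $e'$ contributes to the degree of $f_V(u)$. (So normal edges may be mapped to normal edges, loops or semi-edges, and the preimage of a loop at a vertex $v$ is a disjoint union of cycles spanning $f_V^{-1}(v)$.) A graph $A$ is stronger than a graph $B$ if every simple graph that covers $A$ also covers $B$. Let $F(1,1)$ be the graph with one vertex, one semi-edge and one loop. Statement: if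 a graph $A$ has no semi-edges, then $A$ is stronger than $F(1,1)$ if and only if $A$ covers $F(1,1)$. -/

import Mathlib

/-- A finite graph in which multiple edges, loops and semi-edges are allowed. Every edge `e` has
an unordered pair `ends e` of end-vertices, where the pair is `s(v, v)` if `e` is incident with the
single vertex `v` only. Such an edge is either a semi-edge or a loop; `IsSemi` tells which. -/
structure SemiGraph where
  /-- the vertices -/
  V : Type
  /-- the edges (of all three kinds) -/
  E : Type
  [fintypeV : Fintype V]
  [fintypeE : Fintype E]
  /-- the end-vertices of an edge -/
  ends : E → Sym2 V
  /-- the edge is a semi-edge -/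
  IsSemi : E → Prop
  /-- a semi-edge is incident with a single vertex -/
  semi_isDiag : ∀ e, IsSemi e → (ends e).IsDiag

namespace SemiGraph

attribute [instance] SemiGraph.fintypeV SemiGraph.fintypeE

/-- The edge `e` is a loop. -/
def IsLoop (G : SemiGraph) (e : G.E) : Prop := (G.ends e).IsDiag ∧ ¬ G.IsSemi e

/-- The edge `e` is a normal edge: it is incident with two distinct vertices. -/
def IsNormal (G : SemiGraph) (e : G.E) : Prop := ¬ (G.ends e).IsDiag

open scoped Classical in
/-- The contribution of the edge `e` to the degree of the vertex `v`: it is `0` if `e` is not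
incident with `v`; otherwise it is `2` if `e` is a loop and `1` if `e` is a semi-edge or a normal
edge. -/
noncomputable def mult (G : SemiGraph) (v : G.V) (e : G.E) : ℕ :=
  if v ∈ G.ends e then (if G.IsLoop e then 2 else 1) else 0

/-- The degree of a vertex. -/
noncomputable def degree (G : SemiGraph) (v : G.V) : ℕ := ∑ e, G.mult v e

/-- The graph has no semi-edges. -/
def NoSemiEdges (G : SemiGraph) : Prop := ∀ e, ¬ G.IsSemi e

/-- The graph is simple: no semi-edges, no loops, and no two normal edges with the same ends. -/
def IsSimple (G : SemiGraph) : Prop :=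
  G.NoSemiEdges ∧ (∀ e, ¬ G.IsLoop e) ∧
    ∀ e e', G.IsNormal e → G.IsNormal e' → G.ends e = G.ends e' → e = e'

open scoped Classical in
/-- `(fV, fE)` is a covering projection from `G` to `H`. The field `local_bij` is the requirement
that `fE` be a bijection between the edge-neighbourhoods of `u` and of `fV u`, where, as in degrees,
a loop at a vertex is counted twice. Thus the preimage of a normal edge or of a semi-edge contains
exactly one edge (not a loop) at every vertex above an end-vertex of it, and the preimage of a loop
contains either one loop or exactly two other edges at every vertex above its vertex: it is a
spanning disjoint union of cycles, loops being cycles of length 1 and pairs of parallel edges being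
cycles of length 2. -/
structure IsCoveringProjection (G H : SemiGraph) (fV : G.V → H.V) (fE : G.E → H.E) : Prop where
  surjective_V : Function.Surjective fV
  surjective_E : Function.Surjective fE
  degree_eq : ∀ u, H.degree (fV u) = G.degree u
  semi : ∀ e, G.IsSemi e → H.IsSemi (fE e)
  loop : ∀ e, G.IsLoop e → H.IsLoop (fE e)
  incidence : ∀ e, H.ends (fE e) = (G.ends e).map fV
  local_bij : ∀ (u : G.V) (e' : H.E),
    ∑ e with fE e = e', G.mult u e = H.mult (fV u) e'

/-- `G` covers `H`. -/
def Covers (G H : SemiGraph) : Prop :=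
  ∃ (fV : G.V → H.V) (fE : G.E → H.E), IsCoveringProjection G H fV fE

/-- `A` is stronger than `B`: every simple graph that covers `A` also covers `B`. -/
def Stronger (A B : SemiGraph) : Prop :=
  ∀ G : SemiGraph, G.IsSimple → G.Covers A → G.Covers B

/-- The one-vertex graph `F(a, b)` with `a` semi-edges and `b` loops. -/
def F (a b : ℕ) : SemiGraph where
  V := Unit
  E := Fin a ⊕ Fin b
  ends := fun _ => s((), ())
  IsSemi := fun e => e.isLeft = true
  semi_isDiag := fun _ _ => rfl

end SemiGraph

/-!
A graph without semi-edges covers `F(1, 1)` exactly if it is nonempty, cubic and has a perfect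
matching (`covers_F_one_one_iff`): the matching lies over the semi-edge and its complement over the
loop. Coverings compose, so one direction of the theorem is immediate. For the other one, some
simple graph covers `A`, whence `A` is nonempty and cubic, and it remains to show that `A` has a
perfect matching if all its simple covers have one. By Tutte's theorem this follows from Tutte's
inequality for every set `S` of vertices: `A - S` has at most `|S|` components of odd size.

Given `S`, consider a simple cover `G` of `A` of the following shape
(`card_odd_le_of_forall_cover`). It has sheets `j ∈ J`, and for every sheet `j` and every component
`d` of `A - S` a block of `|B|` further sheets `(j, d, b)`. Edges inside the component `d` permute
the block `(j, d)` enlarged by the sheet `j`; all other blocks are permuted within themselves, and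
edges at `S` permute the sheets `J`. Then the copies of `S` in the sheets `J` separate `G` into
classes, one for every pair `(j, d)`, which consist of the copy of `d` in the sheet `j` and of all
of `A` over the block `(j, d)`. As `|B|` is even, the class `(j, d)` is odd exactly if `d` is. A
perfect matching of `G` matches some vertex of every odd class into the separator, which has
`|J| |S|` vertices (`IsPerfectMatching.card_odd_le`). Dividing by `|J|` gives the inequality.

The cover is simple because all the permutations used are shifts by different small amounts in
large cyclic groups (`exists_isGeneric`), which are never equal or inverse to each other. The blocks
are needed for this: without them, edges inside a component would have to stay in one sheet, and
loops and parallel edges would survive.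
-/

namespace SemiGraph

open scoped Classical

/-! ### Incidences and degrees -/

lemma mult_pos_iff {G : SemiGraph} {v : G.V} {e : G.E} : 0 < G.mult v e ↔ v ∈ G.ends e := by
  unfold mult
  split_ifs <;> simp_all

lemma NoSemiEdges.mult_eq {G : SemiGraph} (hG : G.NoSemiEdges) {e : G.E} {a b : G.V}
    (h : G.ends e = s(a, b)) (v : G.V) :
    G.mult v e = (if a = v then 1 else 0) + (if b = v then 1 else 0) := by
  have := hG e
  by_cases hav : a = v <;> by_cases hbv : b = v <;>
    simp [mult, IsLoop, h, this, hav, hbv, eq_comm]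

lemma NoSemiEdges.sum_mult {G : SemiGraph} (hG : G.NoSemiEdges) {e : G.E} {a b : G.V}
    (h : G.ends e = s(a, b)) (W : Finset G.V) :
    ∑ v ∈ W, G.mult v e = (if a ∈ W then 1 else 0) + (if b ∈ W then 1 else 0) := by
  simp [hG.mult_eq h, Finset.sum_add_distrib]

/-! ### Covering projections -/

/-- The degree condition on a covering projection follows from the local bijections. -/
lemma degree_eq_of_local_bij {G H : SemiGraph} {fV : G.V → H.V} {fE : G.E → H.E}
    (h : ∀ (u : G.V) (e' : H.E), ∑ e with fE e = e', G.mult u e = H.mult (fV u) e') (u : G.V) :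
    H.degree (fV u) = G.degree u := by
  simp_rw [degree, ← h]
  exact Finset.sum_fiberwise Finset.univ fE (G.mult u)

lemma Covers.trans {G H K : SemiGraph} (h₁ : G.Covers H) (h₂ : H.Covers K) : G.Covers K := by
  obtain ⟨fV, fE, hf⟩ := h₁
  obtain ⟨gV, gE, hg⟩ := h₂
  refine ⟨gV ∘ fV, gE ∘ fE, hg.surjective_V.comp hf.surjective_V,
    hg.surjective_E.comp hf.surjective_E, fun u => (hg.degree_eq _).trans (hf.degree_eq u),
    fun e he => hg.semi _ (hf.semi e he), fun e he => hg.loop _ (hf.loop e he), fun e => ?_,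
    fun u e' => ?_⟩
  · simp [hg.incidence, hf.incidence, Sym2.map_map]
  · rw [Function.comp_apply, ← hg.local_bij,
      Finset.sum_congr rfl fun e _ => (hf.local_bij u e).symm,
      ← Finset.sum_fiberwise_of_maps_to (s := Finset.univ.filter fun e => (gE ∘ fE) e = e')
      (t := Finset.univ.filter fun e => gE e = e') (g := fE) (by simp)]
    refine Finset.sum_congr rfl fun e he => Finset.sum_congr ?_ fun _ _ => rfl
    ext x
    simp only [Finset.mem_filter, Finset.mem_univ, true_and, Function.comp_apply] at he ⊢
    exact ⟨fun h => h.2, fun h => ⟨h ▸ he, h⟩⟩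

/-! ### Perfect matchings -/

/-- A set of edges that contributes exactly `1` to the degree of every vertex. For a graph without
semi-edges this is a perfect matching in the usual sense; it cannot contain a loop. -/
def IsPerfectMatching (G : SemiGraph) (M : Set G.E) : Prop :=
  ∀ v, ∑ e with e ∈ M, G.mult v e = 1

lemma IsPerfectMatching.eq_of_mem {G : SemiGraph} {M : Set G.E} (hM : G.IsPerfectMatching M)
    {v : G.V} {e e' : G.E} (he : e ∈ M) (he' : e' ∈ M) (hv : v ∈ G.ends e)
    (hv' : v ∈ G.ends e') : e = e' := by
  by_contra hne
  have h : ∑ x ∈ {e, e'}, G.mult v x ≤ ∑ x with x ∈ M, G.mult v x :=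
    Finset.sum_le_sum_of_subset (by intro x; simp; rintro (rfl | rfl) <;> assumption)
  rw [hM v, Finset.sum_pair hne] at h
  have h₁ := mult_pos_iff.2 hv
  have h₂ := mult_pos_iff.2 hv'
  omega

/-- A vertex set of odd size is left by some matching edge: otherwise the matching edges would
count its vertices in pairs. -/
lemma IsPerfectMatching.exists_ends_of_odd {G : SemiGraph} (hG : G.NoSemiEdges) {M : Set G.E}
    (hM : G.IsPerfectMatching M) {W : Finset G.V} (hW : Odd W.card) :
    ∃ e ∈ M, ∃ a ∈ W, ∃ b ∉ W, G.ends e = s(a, b) := by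
  by_contra! hcon
  have hcard : W.card = ∑ e with e ∈ M, ∑ v ∈ W, G.mult v e := by
    rw [Finset.sum_comm, Finset.sum_congr rfl fun v _ => hM v]
    simp
  rw [hcard, ← Nat.not_even_iff_odd] at hW
  refine hW (Finset.even_sum _ fun e he => ?_)
  obtain ⟨a, b, hab⟩ : ∃ a b, G.ends e = s(a, b) := by
    induction h : G.ends e with | _ a b => exact ⟨a, b, rfl⟩
  rw [hG.sum_mult hab]
  have h₁ := hcon e (by simpa using he) a
  have h₂ := hcon e (by simpa using he) b
  by_cases ha : a ∈ W <;> by_cases hb : b ∈ W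
  · simp [ha, hb]
  · exact absurd hab (h₁ ha b hb)
  · exact absurd (hab.trans Sym2.eq_swap) (h₂ hb a ha)
  · simp [ha, hb]

lemma mult_F {a b : ℕ} (e : Fin a ⊕ Fin b) : (F a b).mult () e = if e.isLeft then 1 else 2 := by
  rcases e with e | e <;> simp [mult, IsLoop, F] <;> exact Sym2.mem_mk_left _ _

/-- Coverings of `F(1, 1)` by graphs without semi-edges are perfect matchings of cubic graphs: the
matching is the preimage of the semi-edge, and its complement is the preimage of the loop. -/
lemma covers_F_one_one_iff {G : SemiGraph} (hG : G.NoSemiEdges) :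
    G.Covers (F 1 1) ↔
      Nonempty G.V ∧ (∀ v, G.degree v = 3) ∧ ∃ M, G.IsPerfectMatching M := by
  constructor
  · rintro ⟨fV, fE, hf⟩
    refine ⟨(hf.surjective_V ()).nonempty, fun v => ?_, {e | fE e = Sum.inl 0}, fun v => ?_⟩
    · rw [← hf.degree_eq v, degree]
      change ∑ e : Fin 1 ⊕ Fin 1, (F 1 1).mult () e = 3
      simp [mult_F]
    · exact (hf.local_bij v (Sum.inl 0)).trans (mult_F _)
  · rintro ⟨⟨v₀⟩, hdeg, M, hM⟩
    have hcompl : ∀ v, ∑ e with e ∉ M, G.mult v e = 2 := by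
      intro v
      have h := Finset.sum_filter_add_sum_filter_not Finset.univ (· ∈ M) (G.mult v)
      have h₁ := hM v
      have h₂ := hdeg v
      unfold degree at h₂
      omega
    let fE : G.E → (F 1 1).E := fun e => if e ∈ M then Sum.inl 0 else Sum.inr 0
    have hfE₁ : ∀ e, fE e = Sum.inl 0 ↔ e ∈ M := by
      intro e
      by_cases h : e ∈ M
      · simp [fE, h]; rfl
      · simp [fE, h]
    have hfE₂ : ∀ e, fE e = Sum.inr 0 ↔ e ∉ M := by
      intro e
      by_cases h : e ∈ M
      · simp [fE, h]
      · simp [fE, h]; rfl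
    have hlocal : ∀ (u : G.V) (e' : (F 1 1).E),
        ∑ e with fE e = e', G.mult u e = (F 1 1).mult () e' := by
      rintro u (i | i) <;> obtain rfl := Subsingleton.elim i 0 <;> rw [mult_F]
      · simp only [hfE₁]; exact hM u
      · simp only [hfE₂]; exact hcompl u
    refine ⟨fun _ => (), fE, fun _ => ⟨v₀, rfl⟩, fun e' => ?_, degree_eq_of_local_bij hlocal,
      fun e he => absurd he (hG e), fun e he => ?_, fun e => ?_, hlocal⟩
    · have h := hlocal v₀ e'
      have hpos : 0 < (F 1 1).mult () e' := (mult_F e').symm ▸ by split_ifs <;> simp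
      obtain ⟨e, he, -⟩ := Finset.exists_ne_zero_of_sum_ne_zero (h ▸ hpos).ne'
      exact ⟨e, by simpa using he⟩
    · -- a loop contributes `2` to its vertex, so it does not belong to the matching
      have heM : e ∉ M := by
        intro heM
        obtain ⟨a, ha⟩ : ∃ a, a ∈ G.ends e := ⟨_, Sym2.out_fst_mem _⟩
        have h := Finset.single_le_sum (f := G.mult a) (fun _ _ => Nat.zero_le _)
          (show e ∈ Finset.univ.filter (· ∈ M) by simpa using heM)
        rw [hM a] at h
        simp [mult, ha, he] at h
      rw [(hfE₂ e).2 heM]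
      simp [IsLoop, F]
    · induction G.ends e with | _ a b => rfl

/-! ### Separated graphs -/

/-- The labels `c` separate the graph: vertices labelled `none` form the separator, and every edge
between other vertices joins vertices of the same label. -/
def IsSeparatedBy (G : SemiGraph) {D : Type} (c : G.V → Option D) : Prop :=
  ∀ e a b, G.ends e = s(a, b) → c a = none ∨ c b = none ∨ c a = c b

/-- The easy half of Tutte's condition: every odd class is matched into the separator. -/
lemma IsPerfectMatching.card_odd_le {G : SemiGraph} (hG : G.NoSemiEdges) {M : Set G.E}
    (hM : G.IsPerfectMatching M) {D : Type} {c : G.V → Option D} (hc : G.IsSeparatedBy c) :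
    Nat.card {d // Odd (Nat.card {v // c v = some d})} ≤ Nat.card {v // c v = none} := by
  have key : ∀ d : {d // Odd (Nat.card {v // c v = some d})},
      ∃ e a b, e ∈ M ∧ c a = some d.1 ∧ c b = none ∧ G.ends e = s(a, b) := by
    rintro ⟨d, hd⟩
    rw [Nat.card_eq_fintype_card, Fintype.card_subtype] at hd
    obtain ⟨e, he, a, ha, b, hb, hab⟩ := hM.exists_ends_of_odd hG hd
    simp only [Finset.mem_filter, Finset.mem_univ, true_and] at ha hb
    refine ⟨e, a, b, he, ha, ?_, hab⟩
    rcases hc e a b hab with h | h | h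
    · simp [h] at ha
    · exact h
    · exact absurd (h.symm.trans ha) hb
  choose e a b he ha hb hab using key
  refine Nat.card_le_card_of_injective (fun d => ⟨b d, hb d⟩) fun d d' h => ?_
  replace h : b d = b d' := congrArg Subtype.val h
  have hee : e d = e d' := hM.eq_of_mem (v := b d) (he d) (he d') (by simp [hab]) (by simp [hab, h])
  have haa : s(a d, b d) = s(a d', b d) := by rw [← hab, hee, hab, h]
  have := (ha d).symm.trans ((congrArg c (Sym2.congr_left.1 haa)).trans (ha d'))
  exact Subtype.ext (Option.some.inj this)

/-! ### Covers from permutation voltages -/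

/-- The cover of `A` with sheets `K` given by the permutation voltages `σ`: over an edge `e` from
`a` to `b`, in the orientation chosen by `Quot.out`, there are the edges from `(a, x)` to
`(b, σ e x)`. Edges with the same end-vertices are oriented alike. -/
noncomputable def voltageCover (A : SemiGraph) (K : Type) [Fintype K]
    (σ : A.E → Equiv.Perm K) : SemiGraph where
  V := A.V × K
  E := A.E × K
  ends := fun e => s(((A.ends e.1).out.1, e.2), ((A.ends e.1).out.2, σ e.1 e.2))
  IsSemi := fun _ => False
  semi_isDiag := fun _ h => h.elim

variable {A : SemiGraph} {K : Type} [Fintype K] {σ : A.E → Equiv.Perm K}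

lemma ends_eq_out (A : SemiGraph) (e : A.E) :
    A.ends e = s((A.ends e).out.1, (A.ends e).out.2) :=
  (Quot.out_eq (A.ends e)).symm

lemma voltageCover_isSimple
    (h₁ : ∀ e e' x, A.ends e = A.ends e' → σ e x = σ e' x → e = e')
    (h₂ : ∀ e e' x, A.ends e = A.ends e' → σ e (σ e' x) ≠ x) :
    (A.voltageCover K σ).IsSimple := by
  refine ⟨fun _ h => h, ?_, ?_⟩
  · rintro ⟨e, x⟩ ⟨h, -⟩
    have h' : ((A.ends e).out.1, x) = ((A.ends e).out.2, σ e x) := Sym2.mk_isDiag_iff.1 h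
    have hx : σ e x = x := (congrArg Prod.snd h').symm
    exact h₂ e e x rfl (by rw [hx, hx])
  · rintro ⟨e, x⟩ ⟨e', x'⟩ - - h
    -- projecting to `A` shows that `e` and `e'` are parallel
    have hp := congrArg (Sym2.map Prod.fst) h
    have hee : A.ends e = A.ends e' := by
      rw [ends_eq_out A e, ends_eq_out A e']
      exact hp
    simp only [voltageCover, hee, Sym2.eq_iff, Prod.mk.injEq] at h
    rcases h with ⟨⟨-, rfl⟩, -, h⟩ | ⟨⟨-, h⟩, -, h'⟩
    · rw [h₁ e e' x hee h]
    · exact absurd (h ▸ h') (h₂ e e' x' hee)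

lemma voltageCover_covers [Nonempty K] (hA : A.NoSemiEdges)
    (hσ : (A.voltageCover K σ).IsSimple) : (A.voltageCover K σ).Covers A := by
  have hlocal : ∀ (u : A.V × K) (e' : A.E),
      ∑ e : A.E × K with e.1 = e', (A.voltageCover K σ).mult u e = A.mult u.1 e' := by
    rintro ⟨u, k⟩ e'
    have hfib : (Finset.univ.filter fun e : A.E × K => e.1 = e') =
        Finset.univ.map ⟨fun x : K => (e', x), Prod.mk_right_injective e'⟩ := by
      ext ⟨e, x⟩
      simp [eq_comm]
    rw [hfib, hA.mult_eq (ends_eq_out A e') u]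
    refine (Finset.sum_map _ _ _).trans ?_
    have hm : ∀ x : K, (A.voltageCover K σ).mult (u, k) (e', x) =
        (if (A.ends e').out.1 = u then if x = k then 1 else 0 else 0) +
        (if (A.ends e').out.2 = u then if x = (σ e').symm k then 1 else 0 else 0) := by
      intro x
      refine (hσ.1.mult_eq (e := ((e', x) : A.E × K)) (a := ((A.ends e').out.1, x))
        (b := ((A.ends e').out.2, σ e' x)) rfl (u, k)).trans ?_
      simp only [Equiv.eq_symm_apply, ← ite_and]
      congr 1 <;> exact if_congr Prod.mk_inj rfl rfl
    refine (Finset.sum_congr rfl fun x _ => hm x).trans ?_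
    rw [Finset.sum_add_distrib]
    congr 1 <;> split_ifs <;> simp
  refine ⟨Prod.fst, Prod.fst, Prod.fst_surjective, Prod.fst_surjective,
    degree_eq_of_local_bij hlocal, fun _ h => h.elim, fun e he => absurd he (hσ.2.1 e),
    fun e => ends_eq_out A e.1, hlocal⟩

/-! ### Permutations in general position -/

/-- A permutation voltage `τ` is generic if different edges shift every sheet differently and no
two shifts are inverse to each other anywhere. -/
def IsGeneric {E X : Type} (τ : E → Equiv.Perm X) : Prop :=
  (∀ e e' x, τ e x = τ e' x → e = e') ∧ ∀ e e' x, τ e (τ e' x) ≠ x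

/-- The shifts of a cyclic group of order `n > 2 |E|` by `1, …, |E|` are generic. -/
lemma exists_isGeneric (E X : Type) [Fintype E] [Fintype X]
    (h : 2 * Fintype.card E < Fintype.card X) : ∃ τ : E → Equiv.Perm X, IsGeneric τ := by
  obtain ⟨n, hn⟩ : ∃ n, Fintype.card X = n := ⟨_, rfl⟩
  have : NeZero n := ⟨by omega⟩
  let f : X ≃ ZMod n := Fintype.equivOfCardEq (by simp [hn])
  let g := Fintype.equivFin E
  let i : E → ℕ := fun e => (g e : ℕ) + 1
  have hi : ∀ e, i e < n := fun e => by have := (g e).2; simp only [i]; omega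
  refine ⟨fun e => (f.trans (Equiv.addRight (i e : ZMod n))).trans f.symm,
    fun e e' x hx => ?_, fun e e' x hx => ?_⟩
  · have h₁ : (i e : ZMod n) = i e' := by simpa using hx
    have := hi e
    have := hi e'
    rw [ZMod.natCast_eq_natCast_iff', Nat.mod_eq_of_lt (by omega),
      Nat.mod_eq_of_lt (by omega)] at h₁
    exact g.injective (Fin.ext (Nat.succ.inj h₁))
  · have h₁ : ((i e' + i e : ℕ) : ZMod n) = 0 := by
      rw [Equiv.trans_apply, Equiv.symm_apply_eq] at hx
      push_cast
      simpa [add_assoc] using hx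
    rw [ZMod.natCast_eq_zero_iff] at h₁
    have h₂ := Nat.le_of_dvd (Nat.add_pos_left (Nat.succ_pos _) _) h₁
    have := (g e).2
    have := (g e').2
    simp only [i] at h₂
    omega

/-- Every graph without semi-edges has a simple cover. -/
lemma exists_isSimple_covers {A : SemiGraph} (hA : A.NoSemiEdges) :
    ∃ G : SemiGraph, G.IsSimple ∧ G.Covers A := by
  obtain ⟨τ, hτ⟩ := exists_isGeneric A.E (Fin (2 * Fintype.card A.E + 1)) (by simp)
  have h : (A.voltageCover _ τ).IsSimple :=
    voltageCover_isSimple (fun e e' x _ => hτ.1 e e' x) fun e e' x _ => hτ.2 e e' x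
  exact ⟨_, h, voltageCover_covers hA h⟩

/-! ### The voltages of a separated graph -/

section Sheets

variable {J D B : Type}

/-- The sheets are `j : J`, written `.inl j`, and blocks of sheets `(j, d', b)` with `b : B`. Over
the edges inside the class `d` the block `(j, d)`, enlarged by the sheet `j` in the role of `none`, is
permuted by `π`; every other block is permuted by `ρ`. -/
noncomputable def innerFun (d : D) (π : Option B → Option B) (ρ : B → B) :
    J ⊕ J × D × B → J ⊕ J × D × B
  | .inl j => (π none).elim (.inl j) fun b => .inr (j, d, b)
  | .inr (j, d', b) =>
    if d' = d then (π (some b)).elim (.inl j) fun b => .inr (j, d, b) else .inr (j, d', ρ b)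

lemma innerFun_comp (d : D) (π π' : Option B → Option B) (ρ ρ' : B → B) (x : J ⊕ J × D × B) :
    innerFun d π ρ (innerFun d π' ρ' x) = innerFun d (π ∘ π') (ρ ∘ ρ') x := by
  rcases x with j | ⟨j, d', b⟩
  · cases h : π' none <;> simp [innerFun, h]
  · by_cases hd : d' = d
    · cases h : π' (some b) <;> simp [innerFun, h, hd]
    · simp [innerFun, hd]

lemma innerFun_id (d : D) (x : J ⊕ J × D × B) : innerFun d id id x = x := by
  rcases x with j | ⟨j, d', b⟩
  · simp [innerFun]
  · by_cases hd : d' = d <;> simp [innerFun, hd]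

/-- `innerFun` as a permutation of the sheets. -/
noncomputable def innerPerm (d : D) (π : Equiv.Perm (Option B)) (ρ : Equiv.Perm B) :
    Equiv.Perm (J ⊕ J × D × B) where
  toFun := innerFun d π ρ
  invFun := innerFun d π.symm ρ.symm
  left_inv x := by rw [innerFun_comp]; simp [innerFun_id]
  right_inv x := by rw [innerFun_comp]; simp [innerFun_id]

/-- Over the edges at the separator the sheets outside the blocks are permuted by `π`, and every
block is permuted by `ρ`. -/
def outerPerm (π : Equiv.Perm J) (ρ : Equiv.Perm B) : Equiv.Perm (J ⊕ J × D × B) :=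
  Equiv.sumCongr π (Equiv.prodCongr (Equiv.refl J) (Equiv.prodCongr (Equiv.refl D) ρ))

/-- The voltages `innerPerm` and `outerPerm`, for edges labelled by the class containing them and by
`none`, respectively. -/
noncomputable def sheetPerm {E : Type} (τJ : E → Equiv.Perm J) (τB : E → Equiv.Perm B)
    (τO : E → Equiv.Perm (Option B)) (t : E → Option D) (e : E) :
    Equiv.Perm (J ⊕ J × D × B) :=
  (t e).elim (outerPerm (τJ e) (τB e)) fun d => innerPerm d (τO e) (τB e)

variable {E : Type} {τJ : E → Equiv.Perm J} {τB : E → Equiv.Perm B}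
  {τO : E → Equiv.Perm (Option B)} {t : E → Option D}

lemma innerFun_ne_self {d : D} {π : Option B → Option B} {ρ : B → B}
    (hπ : ∀ y, π y ≠ y) (hρ : ∀ y, ρ y ≠ y) (x : J ⊕ J × D × B) : innerFun d π ρ x ≠ x := by
  rcases x with j | ⟨j, d', b⟩
  · cases h : π none
    · exact absurd h (hπ none)
    · simp [innerFun, h]
  · by_cases hd : d' = d
    · have := hπ (some b)
      cases h : π (some b) <;> simp_all [innerFun]
    · simpa [innerFun, hd] using hρ b

lemma sheetPerm_injective (hJ : IsGeneric τJ) (hB : IsGeneric τB) (hO : IsGeneric τO)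
    {e e' : E} (ht : t e = t e') {x : J ⊕ J × D × B}
    (h : sheetPerm τJ τB τO t e x = sheetPerm τJ τB τO t e' x) : e = e' := by
  unfold sheetPerm at h
  rw [← ht] at h
  cases hd : t e with
  | none =>
    rcases x with j | ⟨j, d', b⟩
    · exact hJ.1 e e' j (by simpa [hd, outerPerm] using h)
    · exact hB.1 e e' b (by simpa [hd, outerPerm] using h)
  | some d =>
    simp only [hd, Option.elim_some, innerPerm, Equiv.coe_fn_mk] at h
    rcases x with j | ⟨j, d', b⟩
    · refine hO.1 e e' none ?_
      cases h₁ : τO e none <;> cases h₂ : τO e' none <;> simp_all [innerFun]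
    · by_cases hd' : d' = d
      · refine hO.1 e e' (some b) ?_
        cases h₁ : τO e (some b) <;> cases h₂ : τO e' (some b) <;> simp_all [innerFun]
      · exact hB.1 e e' b (by simpa [innerFun, hd'] using h)

lemma sheetPerm_sheetPerm_ne (hJ : IsGeneric τJ) (hB : IsGeneric τB) (hO : IsGeneric τO)
    {e e' : E} (ht : t e = t e') (x : J ⊕ J × D × B) :
    sheetPerm τJ τB τO t e (sheetPerm τJ τB τO t e' x) ≠ x := by
  unfold sheetPerm
  rw [← ht]
  cases hd : t e with
  | none =>
    rcases x with j | ⟨j, d', b⟩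
    · simpa [outerPerm] using hJ.2 e e' j
    · simpa [outerPerm] using hB.2 e e' b
  | some d =>
    simp only [Option.elim_some, innerPerm, Equiv.coe_fn_mk]
    rw [innerFun_comp]
    exact innerFun_ne_self (hO.2 e e') (hB.2 e e') x

/-- The block of sheets containing a vertex of the cover outside the separator: over the class
`d`, the sheet `j` counts as part of the block `(j, d)`. -/
def blockLabel {V : Type} (c : V → Option D) : V × (J ⊕ J × D × B) → Option (J × D)
  | (v, .inl j) => (c v).map (j, ·)
  | (_, .inr (j, d, _)) => some (j, d)

/-- Passing along an edge between vertices `a` and `b` either stays within a block or meets the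
separator. -/
lemma blockLabel_sheetPerm {V : Type} {c : V → Option D} {e : E} {a b : V}
    (hnone : t e = none → c a = none ∨ c b = none)
    (hsome : ∀ d, t e = some d → c a = some d ∧ c b = some d) (x : J ⊕ J × D × B) :
    blockLabel c (a, x) = none ∨ blockLabel c (b, sheetPerm τJ τB τO t e x) = none ∨
      blockLabel c (a, x) = blockLabel c (b, sheetPerm τJ τB τO t e x) := by
  unfold sheetPerm
  cases hd : t e with
  | none =>
    rcases x with j | ⟨j, d', y⟩
    · rcases hnone hd with h | h <;> simp [blockLabel, outerPerm, h]
    · simp [blockLabel, outerPerm]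
  | some d =>
    obtain ⟨ha, hb⟩ := hsome d hd
    right; right
    rcases x with j | ⟨j, d', y⟩
    · cases h : τO e none <;> simp [innerPerm, innerFun, blockLabel, h, ha, hb]
    · by_cases hd' : d' = d
      · cases h : τO e (some y) <;> simp [innerPerm, innerFun, blockLabel, h, hb, hd']
      · simp [innerPerm, innerFun, blockLabel, hd']

/-- The separator of the cover consists of the sheets `j` of the separator. -/
lemma card_blockLabel_none {V : Type} (c : V → Option D) :
    Nat.card {p : V × (J ⊕ J × D × B) // blockLabel c p = none} =
      Nat.card {v // c v = none} * Nat.card J := by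
  rw [← Nat.card_prod]
  refine Nat.card_congr ⟨fun p => match p with
    | ⟨(v, .inl j), h⟩ => (⟨v, by simpa [blockLabel] using h⟩, j)
    | ⟨(v, .inr (j, d, b)), h⟩ => (by simp [blockLabel] at h),
    fun q => ⟨(q.1.1, .inl q.2), by simp [blockLabel, q.1.2]⟩, ?_, fun _ => rfl⟩
  rintro ⟨⟨v, j | ⟨j, d, b⟩⟩, h⟩
  · rfl
  · simp [blockLabel] at h

/-- The class `(j, d)` of the cover is made of a copy of the class `d` and of `|B|` copies of the
whole graph. -/
lemma card_blockLabel_some {V : Type} [Finite V] [Finite B] (c : V → Option D) (j : J) (d : D) :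
    Nat.card {p : V × (J ⊕ J × D × B) // blockLabel c p = some (j, d)} =
      Nat.card {v // c v = some d} + Nat.card V * Nat.card B := by
  rw [← Nat.card_prod, ← Nat.card_sum]
  refine (Nat.card_congr (Equiv.ofBijective (fun q => match q with
    | .inl v => ⟨(v.1, .inl j), by simp [blockLabel, v.2]⟩
    | .inr (v, b) => ⟨(v, .inr (j, d, b)), by simp [blockLabel]⟩) ⟨?_, ?_⟩)).symm
  · rintro (⟨v, hv⟩ | ⟨v, b⟩) (⟨v', hv'⟩ | ⟨v', b'⟩) h <;>
      simpa [Subtype.ext_iff] using congrArg Subtype.val h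
  · rintro ⟨⟨v, j' | ⟨j', d', b⟩⟩, h⟩
    · obtain ⟨hv, rfl⟩ : c v = some d ∧ j' = j := by simpa [blockLabel, and_comm] using h
      exact ⟨.inl ⟨v, hv⟩, rfl⟩
    · obtain ⟨rfl, rfl⟩ : j' = j ∧ d' = d := by simpa [blockLabel] using h
      exact ⟨.inr (v, b), rfl⟩

end Sheets

/-! ### A cover that detects every Tutte set -/

/-- If every simple cover of `A` has a perfect matching, then `A` satisfies Tutte's inequality for
every separator. The cover `voltageCover` with the voltages `sheetPerm` multiplies both sides of the
inequality by `|J|`. The block size `|B|` is even so that the classes keep their parity. -/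
lemma card_odd_le_of_forall_cover {A : SemiGraph} (hA : A.NoSemiEdges)
    (h : ∀ G : SemiGraph, G.IsSimple → G.Covers A → ∃ M, G.IsPerfectMatching M)
    {D : Type} [Finite D] {c : A.V → Option D} (hc : A.IsSeparatedBy c) :
    Nat.card {d // Odd (Nat.card {v // c v = some d})} ≤ Nat.card {v // c v = none} := by
  have := Fintype.ofFinite D
  let J := Fin (2 * Fintype.card A.E + 2)
  obtain ⟨τ, hτ⟩ := exists_isGeneric A.E J (by simp [J])
  obtain ⟨τO, hO⟩ := exists_isGeneric A.E (Option J) (by simp [J])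
  let src : A.E → A.V := fun e => (A.ends e).out.1
  let tgt : A.E → A.V := fun e => (A.ends e).out.2
  let t : A.E → Option D := fun e => if c (src e) = c (tgt e) then c (src e) else none
  have ht : ∀ {e e'}, A.ends e = A.ends e' → t e = t e' := fun h => by simp [t, src, tgt, h]
  let σ := sheetPerm (J := J) τ τ τO t
  have hsimple : (A.voltageCover (J ⊕ J × D × J) σ).IsSimple :=
    voltageCover_isSimple (fun e e' x he hx => sheetPerm_injective hτ hτ hO (ht he) hx)
      fun e e' x he => sheetPerm_sheetPerm_ne hτ hτ hO (ht he) x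
  obtain ⟨M, hM⟩ := h _ hsimple (voltageCover_covers hA hsimple)
  have hsep : (A.voltageCover (J ⊕ J × D × J) σ).IsSeparatedBy (blockLabel c) := by
    rintro ⟨e, x⟩ a b hab
    have hstep : blockLabel c (src e, x) = none ∨ blockLabel c (tgt e, σ e x) = none ∨
        blockLabel c (src e, x) = blockLabel c (tgt e, σ e x) := by
      refine blockLabel_sheetPerm (fun hnone => ?_) (fun d hd => ?_) x
      · rcases hc e (src e) (tgt e) (ends_eq_out A e) with h | h | h
        · exact Or.inl h
        · exact Or.inr h
        · exact Or.inl (by simpa [t, h] using hnone)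
      · by_cases hst : c (src e) = c (tgt e)
        · have : c (src e) = some d := by simpa [t, hst] using hd
          exact ⟨this, hst ▸ this⟩
        · simp [t, hst] at hd
    rcases Sym2.eq_iff.1 hab with ⟨rfl, rfl⟩ | ⟨rfl, rfl⟩
    · exact hstep
    · rcases hstep with h | h | h
      · exact Or.inr (Or.inl h)
      · exact Or.inl h
      · exact Or.inr (Or.inr h.symm)
  have hle := hM.card_odd_le hsimple.1 hsep
  have hnone : Nat.card {p : (A.voltageCover (J ⊕ J × D × J) σ).V // blockLabel c p = none} =
      Nat.card {v // c v = none} * Nat.card J := card_blockLabel_none c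
  have hsome : ∀ q : J × D, Odd (Nat.card
      {p : (A.voltageCover (J ⊕ J × D × J) σ).V // blockLabel c p = some q}) ↔
      Odd (Nat.card {v // c v = some q.2}) := by
    rintro ⟨j, d⟩
    have hJ : Even (Nat.card A.V * Nat.card J) :=
      Even.mul_left (by simp [J, Nat.even_add]) _
    refine (iff_of_eq (congrArg Odd (card_blockLabel_some c j d))).trans ?_
    rw [Nat.odd_add, iff_true_right hJ]
  have hcard : Nat.card {q : J × D // Odd (Nat.card
      {p : (A.voltageCover (J ⊕ J × D × J) σ).V // blockLabel c p = some q})} =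
      Nat.card {d // Odd (Nat.card {v // c v = some d})} * Nat.card J := by
    rw [← Nat.card_prod]
    exact Nat.card_congr ⟨fun q => (⟨q.1.2, (hsome q.1).1 q.2⟩, q.1.1),
      fun r => ⟨(r.2, r.1.1), (hsome _).2 r.1.2⟩, fun _ => rfl, fun _ => rfl⟩
  rw [hnone, hcard] at hle
  exact Nat.le_of_mul_le_mul_right hle (by simp [J])

/-! ### Tutte's theorem for graphs with multiple edges -/

/-- The simple graph of adjacency along normal edges. -/
def toSimpleGraph (A : SemiGraph) : SimpleGraph A.V where
  Adj a b := a ≠ b ∧ ∃ e, A.ends e = s(a, b)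
  symm := ⟨fun _ _ ⟨hne, e, he⟩ => ⟨hne.symm, e, he.trans Sym2.eq_swap⟩⟩
  loopless := ⟨fun _ h => h.1 rfl⟩

/-- A perfect matching of the underlying simple graph becomes one of the graph itself on choosing
one edge from each class of parallel matching edges. -/
lemma exists_isPerfectMatching_of_toSimpleGraph {A : SemiGraph} (hA : A.NoSemiEdges)
    {N : A.toSimpleGraph.Subgraph} (hN : N.IsPerfectMatching) :
    ∃ M, A.IsPerfectMatching M := by
  have hedge : ∀ p ∈ N.edgeSet, ∃ e, A.ends e = p := by
    intro p hp
    induction p with | _ a b => exact (N.adj_sub hp).2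
  choose f hf using hedge
  refine ⟨{e | ∃ h : A.ends e ∈ N.edgeSet, e = f _ h}, fun v => ?_⟩
  obtain ⟨w, hw, huniq⟩ := hN.1 (hN.2 v)
  have hvw : s(v, w) ∈ N.edgeSet := hw
  have hne : w ≠ v := (N.adj_sub hw).1.symm
  rw [Finset.sum_eq_single (f _ hvw)]
  · simp [hA.mult_eq (hf _ hvw) v, hne]
  · rintro e he hne'
    rw [← Nat.le_zero, ← not_lt, mult_pos_iff]
    rintro ⟨x, hx⟩
    obtain ⟨hmem, he⟩ : ∃ h : A.ends e ∈ N.edgeSet, e = f _ h := by simpa using he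
    have hxw : x = w := huniq x (by rw [hx] at hmem; exact hmem)
    subst hxw
    exact hne' (he.trans (by congr 1))
  · intro hnot
    refine absurd ?_ hnot
    simp only [Finset.mem_filter, Finset.mem_univ, true_and, Set.mem_ofPred_eq]
    exact ⟨(hf _ hvw).symm ▸ hvw, by congr 1; exact (hf _ hvw).symm⟩

/-- Tutte's theorem: a graph without semi-edges in which no separator leaves too many odd classes
has a perfect matching. -/
lemma exists_isPerfectMatching_of_tutte {A : SemiGraph} (hA : A.NoSemiEdges)
    (h : ∀ (D : Type) [Finite D] (c : A.V → Option D), A.IsSeparatedBy c →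
      Nat.card {d // Odd (Nat.card {v // c v = some d})} ≤ Nat.card {v // c v = none}) :
    ∃ M, A.IsPerfectMatching M := by
  obtain ⟨N, hN⟩ : ∃ N : A.toSimpleGraph.Subgraph, N.IsPerfectMatching := by
    rw [SimpleGraph.tutte]
    intro u
    rw [SimpleGraph.IsTutteViolator, not_lt]
    set H := ((⊤ : A.toSimpleGraph.Subgraph).deleteVerts u).coe with hH
    have hmem : ∀ v, v ∉ u → v ∈ ((⊤ : A.toSimpleGraph.Subgraph).deleteVerts u).verts := by
      intro v hv; simpa using hv
    -- label the vertices outside `u` by their components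
    let c : A.V → Option H.ConnectedComponent := fun v =>
      if hv : v ∈ u then none else some (H.connectedComponentMk ⟨v, hmem v hv⟩)
    have hsep : A.IsSeparatedBy c := by
      intro e a b hab
      by_cases ha : a ∈ u
      · simp [c, ha]
      by_cases hb : b ∈ u
      · simp [c, hb]
      right; right
      by_cases hne : a = b
      · rw [hne]
      · simp only [c, ha, hb, dite_false, Option.some.injEq]
        refine SimpleGraph.ConnectedComponent.sound (SimpleGraph.Adj.reachable ?_)
        have hadj : A.toSimpleGraph.Adj a b := ⟨hne, e, hab⟩
        simp [hH, ha, hb, hadj]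
    have hnone : Nat.card {v // c v = none} = u.ncard := by
      rw [← Nat.card_coe_set_eq]
      exact Nat.card_congr (Equiv.subtypeEquivRight fun v => by simp [c])
    have hsome : ∀ d, Nat.card {v // c v = some d} = d.supp.ncard := by
      intro d
      rw [← Nat.card_coe_set_eq]
      refine Nat.card_congr (Equiv.ofBijective (fun v =>
        have hv : ∃ hu : v.1 ∉ u, H.connectedComponentMk ⟨v.1, hmem v.1 hu⟩ = d := by
          simpa [c] using v.2
        ⟨⟨v.1, hmem v.1 hv.1⟩, hv.2⟩) ⟨fun v w hvw => ?_, ?_⟩)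
      · exact Subtype.ext (congrArg (fun x => x.1.1) hvw)
      · rintro ⟨⟨v, hv⟩, hd⟩
        have hu : v ∉ u := by simpa using hv
        exact ⟨⟨v, by simpa [c, hu] using hd⟩, rfl⟩
    have := h _ c hsep
    simp only [hsome, hnone] at this
    rwa [← Nat.card_coe_set_eq]
  exact exists_isPerfectMatching_of_toSimpleGraph hA hN

end SemiGraph

theorem mainTheorem3 (A : SemiGraph) (hA : A.NoSemiEdges) :
    A.Stronger (SemiGraph.F 1 1) ↔ A.Covers (SemiGraph.F 1 1) := by
  refine ⟨fun h => ?_, fun h G _ hG => hG.trans h⟩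
  obtain ⟨G, hG, fV, fE, hf⟩ := SemiGraph.exists_isSimple_covers hA
  obtain ⟨⟨v⟩, hdeg, -⟩ := (SemiGraph.covers_F_one_one_iff hG.1).1 (h G hG ⟨fV, fE, hf⟩)
  refine (SemiGraph.covers_F_one_one_iff hA).2 ⟨⟨fV v⟩, fun w => ?_, ?_⟩
  · obtain ⟨u, rfl⟩ := hf.surjective_V w
    rw [hf.degree_eq, hdeg]
  · have hpm : ∀ G : SemiGraph, G.IsSimple → G.Covers A → ∃ M, G.IsPerfectMatching M :=
      fun G hG hGA => ((SemiGraph.covers_F_one_one_iff hG.1).1 (h G hG hGA)).2.2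
    exact SemiGraph.exists_isPerfectMatching_of_tutte hA fun D _ c hc =>
      SemiGraph.card_odd_le_of_forall_cover hA hpm hc
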